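/- Let $\mu$ be a Borel probability measure on $\mathbb{R}$, let $g(x)=\int_{\mathbb{R}}e^{i\xi x}\,d\mu(\xi)$, and let $\mathscr{H}_{K_g}$ be the reproducing kernel Hilbert space of the stationary positive definite kernel $K_g(x,y)=g(x-y)$ on $\mathbb{R}$. Assume $g\in L^2(\mathbb{R})$ (Lebesgue measure), so that $T_\lambda\big(\sum_i c_iK_g(\cdot,x_i)\big)=\sum_i c_iK_g(\cdot,x_i)$ defines an operator from $\operatorname{span}\{K_g(\cdot,y):y\in\mathbb{R}\}\subset\mathscr{H}_{K_g}$ to $L^2(\mathbb{R})$. This operator is densely defined and closable; write $T_\lambda$ also for its closure. Let $\alpha>0$ and $\varphi\in L^2(\mathbb{R})$. Then there is exactly one $\psi\in\operatorname{dom}(T_\lambda T_\lambda^*)$ with $(\alpha+T_\lambda T_\lambda^*)\psi=\varphi$, and $f^{g,\lambda}:=T_\lambda^*\psi=T_\lambda^*(\alpha+T_\lambda T_\lambda^*)^{-1}\varphi\in\operatorname{dom}(T_\lambda)$ is the unique minimizer of $\|\varphi-T_\lambda f\|_{L^2}^2+\alpha\|f\|_{\mathscr{H}_{K_g}}^2$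 over $f\in\operatorname{dom}(T_\lambda)$. Let $c\in\mathbb{R}\setminus\{0\}$, and let $\widehat{u}$ denote the $L^2$-Fourier transform of $u\in L^2(\mathbb{R})$ normalized by $\widehat{u}(\xi)=\int_{\mathbb{R}}e^{ic\xi x}u(x)\,dx$ for $u \in L^1\cap L^2$. Then $\widehat{g}$ is real and nonnegative almost everywhere, and the fitted values $T_\lambda f^{g,\lambda}=T_\lambda T_\lambda^*(\alpha+T_\lambda T_\lambda^*)^{-1}\varphi$ satisfy, almost everywhere, $$\widehat{T_\lambda f^{g,\lambda}}=\frac{\widehat{g}}{\alpha+\widehat{g}}\,\widehat{\varphi}.$$ Moreover, with $W f=(f,T_\lambda f)$ and with $\mathscr{H}_{K_g}\times L^2(\mathbb{R})$ carrying the norm $\|(f,u)\|^2=\alpha\|f\|_{\mathscr{H}_{K_g}}^2+\|u\|_{L^2}^2$, $$\|f^{g,\lambda}\|_{\mathscr{H}_{K_g}}^2=\frac{|c|}{2\pi}\int_{\mathbb{R}}\frac{\widehat{g}(\xi)}{(\alpha+\widehat{g}(\xi))^2}\,|\widehat{\varphi}(\xi)|^2\,d\xi,\qquad \|Wf^{g,\lambda}\|_{\mathscr{H}_{K_g}\times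 L^2}^2=\frac{|c|}{2\pi}\int_{\mathbb{R}}\frac{\widehat{g}(\xi)}{\alpha+\widehat{g}(\xi)}\,|\widehat{\varphi}(\xi)|^2\,d\xi,$$ and both integrands are integrable. In particular, for the unitary normalization $|c|=2\pi$ the constant $|c|/(2\pi)$ is $1$. -/

import Mathlib

open MeasureTheory FourierTransform

open scoped LinearPMap

noncomputable section

/-- The linear span of the kernel sections `K(·, y) = RKHS.kerFun H y 1`, inside the reproducing
kernel Hilbert space `H` of complex functions on `X`. -/
def kernelSpan {X : Type*} (H : Type*) [NormedAddCommGroup H] [InnerProductSpace ℂ H]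
    [CompleteSpace H] [RKHS ℂ H X ℂ] : Submodule ℂ H :=
  Submodule.span ℂ (Set.range fun y : X => RKHS.kerFun H y (1 : ℂ))

theorem memLp_of_mem_kernelSpan {X : Type*} [MeasurableSpace X] {H : Type*}
    [NormedAddCommGroup H] [InnerProductSpace ℂ H] [CompleteSpace H] [RKHS ℂ H X ℂ]
    {ν : Measure X} (hK : ∀ y : X, MemLp (⇑(RKHS.kerFun H y (1 : ℂ))) 2 ν)
    {u : H} (hu : u ∈ kernelSpan (X := X) H) : MemLp (⇑u) 2 ν := by
  induction hu using Submodule.span_induction with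
  | mem x hx =>
    obtain ⟨y, rfl⟩ := hx
    exact hK y
  | zero => rw [RKHS.coe_zero]; exact MemLp.zero
  | add x y _ _ hx hy => rw [RKHS.coe_add]; exact hx.add hy
  | smul a x _ hx => rw [RKHS.coe_smul]; exact hx.const_smul a

/-- The operator `H ⊇ span {K(·, y)} → L²(ν)`, `∑ cᵢ K(·, yᵢ) ↦ ∑ cᵢ K(·, yᵢ)`, for a kernel all
of whose sections are square integrable. -/
def kernelInclusion {X : Type*} [MeasurableSpace X] {H : Type*}
    [NormedAddCommGroup H] [InnerProductSpace ℂ H] [CompleteSpace H] [RKHS ℂ H X ℂ]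
    (ν : Measure X) (hK : ∀ y : X, MemLp (⇑(RKHS.kerFun H y (1 : ℂ))) 2 ν) :
    H →ₗ.[ℂ] Lp ℂ 2 ν where
  domain := kernelSpan (X := X) H
  toFun :=
    { toFun := fun u => (memLp_of_mem_kernelSpan hK u.2).toLp
      map_add' := fun u v => by
        rw [← MemLp.toLp_add]
        congr 1
        exact RKHS.coe_add _ _
      map_smul' := fun a u => by
        rw [RingHom.id_apply, ← MemLp.toLp_const_smul]
        congr 1
        exact RKHS.coe_smul _ _ }

/-- `H` has the stationary kernel `K(x, y) = g(x - y)`, where `g(x) = ∫ exp(i ξ x) dμ(ξ)` is the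
characteristic function of `μ`. The kernel of an `RKHS` is valued in operators on `ℂ`, the
number `K(x, y)` acting by multiplication. -/
def HasStationaryKernel (H : Type*) [NormedAddCommGroup H] [InnerProductSpace ℂ H]
    [CompleteSpace H] [RKHS ℂ H ℝ ℂ] (μ : Measure ℝ) : Prop :=
  ∀ (x y : ℝ) (z : ℂ), RKHS.kernel H x y z = charFun μ (x - y) * z

theorem HasStationaryKernel.memLp_kerFun {H : Type*} [NormedAddCommGroup H]
    [InnerProductSpace ℂ H] [CompleteSpace H] [RKHS ℂ H ℝ ℂ] {μ : Measure ℝ}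
    (hH : HasStationaryKernel H μ) (hg : MemLp (charFun μ) 2 (volume : Measure ℝ)) (y : ℝ) :
    MemLp (⇑(RKHS.kerFun H y (1 : ℂ))) 2 (volume : Measure ℝ) := by
  have h : ⇑(RKHS.kerFun H y (1 : ℂ)) = charFun μ ∘ fun x => x - y := by
    funext x
    simp [RKHS.kerFun_apply, hH x y 1]
  rw [h]
  exact hg.comp_measurePreserving (measurePreserving_sub_right volume y)

/-- The operator `H ⊇ span {K(·, y)} → L²(ℝ)`, `∑ cᵢ K(·, yᵢ) ↦ ∑ cᵢ K(·, yᵢ)`, for the kernel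
`K(x, y) = g(x - y)` with `g = charFun μ` square integrable. -/
def stationaryInclusion {H : Type*} [NormedAddCommGroup H] [InnerProductSpace ℂ H]
    [CompleteSpace H] [RKHS ℂ H ℝ ℂ] {μ : Measure ℝ} (hH : HasStationaryKernel H μ)
    (hg : MemLp (charFun μ) 2 (volume : Measure ℝ)) : H →ₗ.[ℂ] Lp ℂ 2 (volume : Measure ℝ) :=
  kernelInclusion volume (hH.memLp_kerFun hg)

/-- The closure `T` of the operator above. -/
def stationaryOperator {H : Type*} [NormedAddCommGroup H] [InnerProductSpace ℂ H]
    [CompleteSpace H] [RKHS ℂ H ℝ ℂ] {μ : Measure ℝ} (hH : HasStationaryKernel H μ)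
    (hg : MemLp (charFun μ) 2 (volume : Measure ℝ)) : H →ₗ.[ℂ] Lp ℂ 2 (volume : Measure ℝ) :=
  (stationaryInclusion hH hg).closure

/-- `ψ = (α + T T†)⁻¹ φ` and `f = T† ψ`, for a possibly unbounded operator `T`: the vector `ψ` lies
in the domain of `T†`, `f = T† ψ` lies in the domain of `T`, and `α ψ + T f = φ`. -/
def IsRegularized {H L : Type*} [NormedAddCommGroup H] [InnerProductSpace ℂ H]
    [NormedAddCommGroup L] [InnerProductSpace ℂ L] [CompleteSpace H]
    (T : H →ₗ.[ℂ] L) (α : ℝ) (φ : L) (ψ : T†.domain) (f : T.domain) : Prop :=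
  (f : H) = T† ψ ∧ (α : ℂ) • (ψ : L) + T f = φ

/-- The map `W u = (u, T u)`. -/
def graphMap {H L : Type*} [AddCommGroup H] [Module ℂ H] [AddCommGroup L] [Module ℂ L]
    (T : H →ₗ.[ℂ] L) (u : T.domain) : H × L :=
  (u, T u)

/-- The squared norm of the Hilbert space `H × L` with the weighted inner product
`⟨(u₁, u₂), (v₁, v₂)⟩ = α ⟨u₁, v₁⟩ + ⟨u₂, v₂⟩`. -/
def weightedNormSq {H L : Type*} [Norm H] [Norm L] (α : ℝ) (p : H × L) : ℝ :=
  α * ‖p.1‖ ^ 2 + ‖p.2‖ ^ 2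

/-- The `L²` Fourier transform with kernel `exp(i c ξ x)`, i.e. the continuous extension to `L²(ℝ)`
of `u ↦ (ξ ↦ ∫ exp(i c ξ x) u(x) dx)`. Mathlib's `𝓕` has the kernel `exp(-2π i ξ x)`. -/
def l2Fourier (c : ℝ) (u : Lp ℂ 2 (volume : Measure ℝ)) (ξ : ℝ) : ℂ :=
  (𝓕 u : Lp ℂ 2 (volume : Measure ℝ)) (-(c * ξ / (2 * Real.pi)))

end

/-! Square integrability of `g` forces the law `μ`, rescaled by `1/(2π)`, to have an integrable
density `G ≥ 0`, and `𝓕 g = G` a.e. (`exists_isSpectralDensity`, `fourier_toLp`). The vectors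
`exp(-2πiηy) √G(η)` of `L²` have the Gram matrix `g(x - y)`, so `K(·, y)` can be sent to them by an
isometry `V` of `H` into `L²`. Since the transform of `K(·, y)` is `exp(-2πiηy) G(η)`, the operator
`T` becomes multiplication by `√G` after `V`, and `T T†` becomes multiplication by `G`.

With `Φ = 𝓕 φ` this dictates the candidates `𝓕 ψ = Φ/(α+G)`, `𝓕 S = GΦ/(α+G)` and `w = V*(√G
Φ/(α+G))`. In `exists_resolvent` they are checked only weakly, against kernel sections and against
the domain of `T†`. The weak identities suffice: for `α = 1` they give density of that domain, hence
closability, and then by `mem_graph_closure` they place `(w, S)` in the graph of the closure.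

The norms come from `‖w‖² = ⟨ψ, S⟩` and `α‖w‖² + ‖S‖² = ⟨φ, S⟩` by Plancherel; the substitution `η =
-cξ/(2π)` produces the factor `|c|/(2π)`. -/

namespace LinearPMap

/-! ### Unbounded operators: adjoints and closures. -/

section Adjoint

variable {𝕜 E F : Type*} [RCLike 𝕜] [NormedAddCommGroup E] [InnerProductSpace 𝕜 E]
  [NormedAddCommGroup F] [InnerProductSpace 𝕜 F] [CompleteSpace E] {T : E →ₗ.[𝕜] F}

theorem isClosable_of_dense_adjoint_domain [CompleteSpace F] (hT : Dense (T.domain : Set E))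
    (hT' : Dense (T†.domain : Set F)) : T.IsClosable :=
  isClosable_iff_exists_closed_extension.2
    ⟨T††, adjoint_isClosed hT', (adjoint_isFormalAdjoint hT).le_adjoint hT'⟩

/-- Orthogonality to the graph is a closed condition, so it passes from the graph of `T` to its
closure. -/
theorem IsClosable.adjoint_closure (hc : T.IsClosable) (hT : Dense (T.domain : Set E)) :
    T.closure† = T† := by
  apply eq_of_eq_graph
  rw [adjoint_graph_eq_graph_adjoint (hT.mono (le_closure T).1), adjoint_graph_eq_graph_adjoint hT]
  ext x
  rw [Submodule.mem_adjoint_iff, Submodule.mem_adjoint_iff]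
  refine ⟨fun h a b hab => h a b (le_graph_of_le (le_closure T) hab), fun h a b hab => ?_⟩
  rw [← hc.graph_closure_eq_closure_graph] at hab
  have hcl : _root_.IsClosed {p : E × F | inner 𝕜 p.2 x.1 - inner 𝕜 p.1 x.2 = 0} :=
    isClosed_eq (by fun_prop) continuous_const
  exact closure_minimal (fun p hp => h p.1 p.2 hp) hcl hab

/-- The closure of the graph is its double orthogonal complement in the Hilbert sum, and vectors
orthogonal to the graph have the form `(-T† χ, χ)`; the hypothesis says that `(f, v)` is orthogonal
to all of these. -/
theorem IsClosable.mem_graph_closure [CompleteSpace F] (hc : T.IsClosable)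
    (hT : Dense (T.domain : Set E)) {f : E} {v : F}
    (h : ∀ χ : T†.domain, inner 𝕜 (T† χ) f = inner 𝕜 (χ : F) v) :
    (f, v) ∈ T.closure.graph := by
  rw [← hc.graph_closure_eq_closure_graph]
  set e := WithLp.prodContinuousLinearEquiv 2 𝕜 E F
  set K : Submodule 𝕜 (WithLp 2 (E × F)) := T.graph.map (e.symm : E × F →ₗ[𝕜] _)
  have hmem : e.symm (f, v) ∈ K.topologicalClosure := by
    rw [← Submodule.orthogonal_orthogonal_eq_closure, Submodule.mem_orthogonal]
    intro u hu
    have hu' : ∀ x : T.domain, inner 𝕜 (-u.fst) (x : E) = inner 𝕜 u.snd (T x) := by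
      intro x
      have hx := Submodule.mem_orthogonal' K u |>.1 hu (e.symm (x, T x)) ⟨(x, T x), T.mem_graph x, rfl⟩
      rw [WithLp.prod_inner_apply] at hx
      rw [inner_neg_left]
      exact neg_eq_of_add_eq_zero_right hx
    have hd : u.snd ∈ T†.domain := mem_adjoint_domain_of_exists _ ⟨_, hu'⟩
    have := h ⟨u.snd, hd⟩
    rw [adjoint_apply_eq hT _ hu', inner_neg_left] at this
    rw [WithLp.prod_inner_apply]
    exact neg_eq_iff_add_eq_zero.1 this
  have := image_closure_subset_closure_image e.continuous ⟨_, hmem, rfl⟩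
  rw [ContinuousLinearEquiv.apply_symm_apply] at this
  refine _root_.closure_mono ?_ this
  rintro _ ⟨_, ⟨p, hp, rfl⟩, rfl⟩
  exact hp

end Adjoint

end LinearPMap

/-! ### Uniqueness of the resolvent and strict minimality. -/

namespace IsRegularized

variable {H L : Type*} [NormedAddCommGroup H] [InnerProductSpace ℂ H] [NormedAddCommGroup L]
  [InnerProductSpace ℂ L] [CompleteSpace H] {T : H →ₗ.[ℂ] L} {α : ℝ} {φ : L}
  {ψ ψ' : T†.domain} {f f' : T.domain}

/-- Pairing `T (f - f') = -α (ψ - ψ')` with `ψ - ψ'` gives `‖f - f'‖² = -α ‖ψ - ψ'‖²`. -/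
theorem unique (hT : Dense (T.domain : Set H)) (hα : 0 < α) (h : IsRegularized T α φ ψ f)
    (h' : IsRegularized T α φ ψ' f') : ψ = ψ' := by
  obtain ⟨h1, h2⟩ := h
  obtain ⟨h1', h2'⟩ := h'
  have ha := LinearPMap.adjoint_isFormalAdjoint hT (ψ - ψ') (f - f')
  rw [LinearPMap.map_sub, ← h1, ← h1', AddSubgroupClass.coe_sub, AddSubgroupClass.coe_sub,
    inner_self_eq_norm_sq_to_K, LinearPMap.map_sub] at ha
  have e : T f - T f' = -((α : ℂ) • ((ψ : L) - ψ')) := by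
    rw [smul_sub, neg_sub, sub_eq_sub_iff_add_eq_add, add_comm, h2, ← h2', add_comm]
  rw [e, inner_neg_right, inner_smul_right, inner_self_eq_norm_sq_to_K] at ha
  have ha' : ‖(f : H) - f'‖ ^ 2 = -(α * ‖(ψ : L) - ψ'‖ ^ 2) := by
    apply Complex.ofReal_injective
    simpa using ha
  have : ‖(ψ : L) - ψ'‖ ^ 2 = 0 := by
    nlinarith [sq_nonneg ‖(f : H) - f'‖, sq_nonneg ‖(ψ : L) - ψ'‖]
  exact Subtype.ext (sub_eq_zero.1 (norm_eq_zero.1 (pow_eq_zero_iff two_ne_zero |>.1 this)))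

/-- Since `φ - T f = α ψ` and `f = T† ψ`, the cross terms cancel when the functional is expanded
around `f`; the excess is `‖T (u - f)‖² + α ‖u - f‖²`. -/
theorem lt_of_ne (hT : Dense (T.domain : Set H)) (hα : 0 < α) (h : IsRegularized T α φ ψ f)
    {u : T.domain} (hu : u ≠ f) :
    ‖φ - T f‖ ^ 2 + α * ‖(f : H)‖ ^ 2 < ‖φ - T u‖ ^ 2 + α * ‖(u : H)‖ ^ 2 := by
  obtain ⟨h1, rfl⟩ := h
  have ha : inner ℂ (f : H) ((u : H) - f) = inner ℂ (ψ : L) (T u - T f) := by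
    rw [← LinearPMap.map_sub, ← AddSubgroupClass.coe_sub, h1]
    exact LinearPMap.adjoint_isFormalAdjoint hT ψ (u - f)
  have e1 : (α : ℂ) • (ψ : L) + T f - T u = (α : ℂ) • (ψ : L) - (T u - T f) := by abel
  have e2 : (u : H) = f + (u - f) := by abel
  have e3 := norm_sub_sq (𝕜 := ℂ) ((α : ℂ) • (ψ : L)) (T u - T f)
  have e4 := norm_add_sq (𝕜 := ℂ) (f : H) (u - f)
  rw [← e1, inner_smul_left, ← ha] at e3
  rw [← e2] at e4
  have e5 : RCLike.re ((starRingEnd ℂ) (α : ℂ) * inner ℂ (f : H) ((u : H) - f)) =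
      α * RCLike.re (inner ℂ (f : H) ((u : H) - f)) := by simp
  have hpos : 0 < ‖(u : H) - f‖ :=
    norm_pos_iff.2 (sub_ne_zero.2 fun h => hu (Subtype.ext h))
  rw [add_sub_cancel_right, e3, e4, e5]
  nlinarith [sq_nonneg ‖T u - T f‖, mul_pos hα (pow_pos hpos 2)]

end IsRegularized

/-! ### Fourier transforms of measures and densities that are square integrable. -/

section Fourier

open scoped SchwartzMap Real ContDiff

/-- Fubini moves the transform onto `𝓕 s`, and Fourier inversion returns `s`. A general `ν` covers
both a Lebesgue density `h` and, with `h = 1`, a measure. -/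
theorem integral_fourier_mul_integral_fourierChar {ν : Measure ℝ} {h : ℝ → ℂ} [SigmaFinite ν]
    (hh : Integrable h ν) (s : 𝓢(ℝ, ℂ)) :
    ∫ x, (𝓕 s : 𝓢(ℝ, ℂ)) x * ∫ η, (𝐞 (η * x) : ℂ) * h η ∂ν = ∫ η, s η * h η ∂ν := by
  have key := VectorFourier.integral_fourierIntegral_smul_eq_flip (μ := ν) (ν := volume)
    (L := -innerₗ ℝ) Real.continuous_fourierChar (by
      simpa using! (continuous_snd.mul continuous_fst).neg) hh
    (𝓕 s).integrable
  have e1 : ∀ x, VectorFourier.fourierIntegral 𝐞 ν (-innerₗ ℝ) h x =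
      ∫ η, (𝐞 (η * x) : ℂ) * h η ∂ν := by
    intro x
    simp [VectorFourier.fourierIntegral, Circle.smul_def, mul_comm]
  have e2 : ∀ x, VectorFourier.fourierIntegral 𝐞 volume (-innerₗ ℝ).flip
      (𝓕 s : 𝓢(ℝ, ℂ)) x = s x := by
    intro x
    conv_rhs => rw [← fourierInv_fourier_eq (F := 𝓢(ℝ, ℂ)) s, SchwartzMap.fourierInv_coe, Real.fourierInv_eq]
    simp [VectorFourier.fourierIntegral, mul_comm]
  simp only [e1, e2, smul_eq_mul] at key
  simpa only [mul_comm] using key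

theorem integral_mul_fourier_of_ae_eq {ν : Measure ℝ} {h : ℝ → ℂ} [SigmaFinite ν]
    (hh : Integrable h ν) {f : Lp ℂ 2 (volume : Measure ℝ)}
    (hf : f =ᵐ[volume] fun x => ∫ η, (𝐞 (η * x) : ℂ) * h η ∂ν) (s : 𝓢(ℝ, ℂ)) :
    ∫ x, s x * (𝓕 f : Lp ℂ 2 (volume : Measure ℝ)) x = ∫ η, s η * h η ∂ν := by
  have key := congrArg (· s) (Lp.fourier_toTemperedDistribution_eq f)
  simp only [TemperedDistribution.fourier_apply, Lp.toTemperedDistribution_apply,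
    smul_eq_mul] at key
  rw [← key, ← integral_fourier_mul_integral_fourierChar hh]
  refine integral_congr_ae ?_
  filter_upwards [hf] with x hx
  rw [hx]

theorem integral_smul_fourier_of_ae_eq {ν : Measure ℝ} {h : ℝ → ℂ} [SigmaFinite ν]
    (hh : Integrable h ν) {f : Lp ℂ 2 (volume : Measure ℝ)}
    (hf : f =ᵐ[volume] fun x => ∫ η, (𝐞 (η * x) : ℂ) * h η ∂ν) {s : ℝ → ℝ}
    (hs : ContDiff ℝ ∞ s) (hc : HasCompactSupport s) :
    ∫ x, s x • (𝓕 f : Lp ℂ 2 (volume : Measure ℝ)) x = ∫ η, s η • h η ∂ν := by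
  have hg₁ : HasCompactSupport (Complex.ofRealCLM ∘ s) := hc.comp_left rfl
  have hg₂ : ContDiff ℝ ∞ (Complex.ofRealCLM ∘ s) := by fun_prop
  simpa using integral_mul_fourier_of_ae_eq hh hf (hg₁.toSchwartzMap hg₂)

theorem locallyIntegrable_Lp_two (f : Lp ℂ 2 (volume : Measure ℝ)) :
    LocallyIntegrable f volume :=
  (Lp.memLp f).locallyIntegrable one_le_two

/-- If an `L²` function is the inverse Fourier transform of an `L¹` function, then the latter
is its `L²` Fourier transform. -/
theorem fourier_ae_eq_of_ae_eq_integral {h : ℝ → ℂ}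
    (hh : Integrable h) {f : Lp ℂ 2 (volume : Measure ℝ)}
    (hf : f =ᵐ[volume] fun x => ∫ η, (𝐞 (η * x) : ℂ) * h η) :
    (𝓕 f : Lp ℂ 2 (volume : Measure ℝ)) =ᵐ[volume] h :=
  ae_eq_of_integral_contDiff_smul_eq (locallyIntegrable_Lp_two _) hh.locallyIntegrable
    fun _ hs hc => integral_smul_fourier_of_ae_eq hh hf hs hc

/-- The difference has inverse transform `0`, which is an `L²` function, so the difference is the
transform of `0`. -/
theorem ae_eq_of_integral_fourierChar_eq {h₁ h₂ : ℝ → ℂ} (hh₁ : Integrable h₁)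
    (hh₂ : Integrable h₂)
    (h : ∀ x, ∫ η, (𝐞 (η * x) : ℂ) * h₁ η = ∫ η, (𝐞 (η * x) : ℂ) * h₂ η) : h₁ =ᵐ[volume] h₂ := by
  have hint : ∀ {k : ℝ → ℂ}, Integrable k → ∀ x, Integrable fun η => (𝐞 (η * x) : ℂ) * k η := by
    intro k hk x
    refine hk.bdd_mul (c := 1) (by fun_prop) (ae_of_all _ fun η => ?_)
    exact (Circle.norm_coe _).le
  have hf : ((0 : Lp ℂ 2 (volume : Measure ℝ)) : ℝ → ℂ) =ᵐ[volume]
      fun x => ∫ η, (𝐞 (η * x) : ℂ) * (h₁ - h₂) η := by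
    filter_upwards [Lp.coeFn_zero ℂ 2 (volume : Measure ℝ)] with x hx
    rw [hx]
    simp only [Pi.sub_apply, mul_sub]
    rw [integral_sub (hint hh₁ x) (hint hh₂ x), h x, sub_self]
    rfl
  have h0 : (𝓕 (0 : Lp ℂ 2 (volume : Measure ℝ)) : Lp ℂ 2 (volume : Measure ℝ)) = 0 :=
    map_zero (Lp.fourierTransformₗᵢ ℝ ℂ)
  have := fourier_ae_eq_of_ae_eq_integral (hh₁.sub hh₂) hf
  rw [h0] at this
  filter_upwards [this, Lp.coeFn_zero ℂ 2 (volume : Measure ℝ)] with x hx hx0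
  rw [hx0] at hx
  exact sub_eq_zero.1 hx.symm

/-- A finite measure that agrees with a complex density on smooth compactly supported functions
is given by this density. -/
theorem integral_eq_of_integral_smul_eq {ν : Measure ℝ} [IsFiniteMeasure ν] {G : ℝ → ℂ}
    (hG : LocallyIntegrable G)
    (h : ∀ s : ℝ → ℝ, ContDiff ℝ ∞ s → HasCompactSupport s →
      ∫ x, s x • G x = ∫ x, (s x : ℂ) ∂ν) :
    Integrable G ∧ (∀ᵐ x, 0 ≤ (G x).re ∧ (G x).im = 0) ∧
      ∀ f : ℝ → ℂ, ∫ x, f x ∂ν = ∫ x, f x * G x := by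
  -- Absolute continuity of `ν` is not known yet, so `ν` and Lebesgue measure are compared through
  -- their densities `a`, `b` with respect to a measure dominating both; testing gives `a = b G`
  -- a.e.
  set ρ : Measure ℝ := ν + volume
  have hν : ν ≪ ρ := Measure.absolutelyContinuous_of_le (Measure.le_add_right le_rfl)
  have hv : (volume : Measure ℝ) ≪ ρ :=
    Measure.absolutelyContinuous_of_le (Measure.le_add_left le_rfl)
  set a : ℝ → ℝ := fun x => (ν.rnDeriv ρ x).toReal
  set b : ℝ → ℝ := fun x => ((volume : Measure ℝ).rnDeriv ρ x).toReal
  have ha : Integrable (fun x => (a x : ℂ)) ρ := Measure.integrable_toReal_rnDeriv.ofReal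
  have hb : LocallyIntegrable (fun x => b x • G x) ρ := by
    refine locallyIntegrable_iff.2 fun K hK => ?_
    rw [← integrable_indicator_iff hK.measurableSet]
    have : K.indicator (fun x => b x • G x) = fun x => b x • K.indicator G x := by
      ext x
      by_cases hx : x ∈ K <;> simp [hx]
    rw [this, integrable_rnDeriv_smul_iff hv, integrable_indicator_iff hK.measurableSet]
    exact locallyIntegrable_iff.1 hG K hK
  have hab : ∀ᵐ x ∂ρ, (a x : ℂ) = b x • G x := by
    refine ae_eq_of_integral_contDiff_smul_eq ha.locallyIntegrable hb fun s hs hc => ?_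
    have e1 : ∀ x, s x • (a x : ℂ) = a x • (s x : ℂ) := fun x => by simp [mul_comm]
    have e2 : ∀ x, s x • b x • G x = b x • s x • G x := fun x => smul_comm _ _ _
    simp only [e1, e2, a, b]
    rw [integral_rnDeriv_smul hν, integral_rnDeriv_smul hv, h s hs hc]
  refine ⟨?_, ?_, fun f => ?_⟩
  · exact (integrable_rnDeriv_smul_iff hv).1 (ha.congr hab)
  · filter_upwards [hv.ae_le hab, Measure.rnDeriv_pos hv, hv.ae_le (Measure.rnDeriv_lt_top volume ρ)]
      with x hx hpos hlt
    have hb : 0 < b x := ENNReal.toReal_pos hpos.ne' hlt.ne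
    have ha : 0 ≤ a x := ENNReal.toReal_nonneg
    have hre := congrArg Complex.re hx
    have him := congrArg Complex.im hx
    simp only [Complex.ofReal_re, Complex.ofReal_im, Complex.real_smul, Complex.re_ofReal_mul,
      Complex.im_ofReal_mul] at hre him
    refine ⟨?_, ?_⟩
    · by_contra! hneg
      nlinarith
    · rcases mul_eq_zero.1 him.symm with h | h
      · exact absurd h hb.ne'
      · exact h
  -- Both sides are integrals against `ρ` of a.e. equal functions, so `f` need not be integrable.
  · rw [← integral_rnDeriv_smul hν, ← integral_rnDeriv_smul hv]
    refine integral_congr_ae ?_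
    filter_upwards [hab] with x hx
    change a x • f x = b x • (f x * G x)
    rw [Complex.real_smul, hx]
    simp only [Complex.real_smul]
    ring

/-- A finite measure whose Fourier transform is square integrable has an integrable density. -/
theorem fourier_density {ν : Measure ℝ} [IsFiniteMeasure ν] {f : Lp ℂ 2 (volume : Measure ℝ)}
    (hf : f =ᵐ[volume] fun x => ∫ η, (𝐞 (η * x) : ℂ) ∂ν) :
    Integrable (𝓕 f : Lp ℂ 2 (volume : Measure ℝ)) ∧
      (∀ᵐ x, 0 ≤ ((𝓕 f : Lp ℂ 2 (volume : Measure ℝ)) x).re ∧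
        ((𝓕 f : Lp ℂ 2 (volume : Measure ℝ)) x).im = 0) ∧
      ∀ k : ℝ → ℂ, ∫ x, k x ∂ν = ∫ x, k x * (𝓕 f : Lp ℂ 2 (volume : Measure ℝ)) x := by
  refine integral_eq_of_integral_smul_eq (locallyIntegrable_Lp_two _) fun s hs hc => ?_
  have := integral_smul_fourier_of_ae_eq (h := fun _ => 1) (integrable_const (μ := ν) (1 : ℂ))
    (by simpa using hf) hs hc
  simpa using this

end Fourier

/-- Equal Gram matrices give equal norms of corresponding finite combinations; the map extends by
density. -/
theorem exists_linearIsometry_of_inner_eq {𝕜 E F ι : Type*} [RCLike 𝕜] [NormedAddCommGroup E]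
    [InnerProductSpace 𝕜 E] [NormedAddCommGroup F] [InnerProductSpace 𝕜 F] [CompleteSpace F]
    {a : ι → E} {b : ι → F} (hab : ∀ i j, inner 𝕜 (a i) (a j) = inner 𝕜 (b i) (b j))
    (ha : Dense (Submodule.span 𝕜 (Set.range a) : Set E)) :
    ∃ V : E →ₗᵢ[𝕜] F, ∀ i, V (a i) = b i := by
  set A : (ι →₀ 𝕜) →ₗ[𝕜] E := Finsupp.linearCombination 𝕜 a
  set B : (ι →₀ 𝕜) →ₗ[𝕜] F := Finsupp.linearCombination 𝕜 b
  have hA : DenseRange A := by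
    rw [DenseRange, ← LinearMap.coe_range, Finsupp.range_linearCombination]
    exact ha
  have hinner : ∀ x, inner 𝕜 (B x) (B x) = inner 𝕜 (A x) (A x) := fun x => by
    simp only [A, B, Finsupp.linearCombination_apply, Finsupp.sum_inner, Finsupp.inner_sum, hab,
      inner_smul_left, inner_smul_right]
  have hnorm : ∀ x, ‖B x‖ = ‖A x‖ := fun x => by
    rw [@norm_eq_sqrt_re_inner 𝕜, hinner, ← @norm_eq_sqrt_re_inner 𝕜]
  have hV := LinearMap.extendOfNorm_eq (f := B) hA ⟨1, fun x => by rw [one_mul, hnorm]⟩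
  refine ⟨⟨(B.extendOfNorm A).toLinearMap, fun x => ?_⟩, fun i => ?_⟩
  · refine hA.induction_on (p := fun x => ‖(B.extendOfNorm A) x‖ = ‖x‖) x
      (isClosed_eq (by fun_prop) (by fun_prop)) fun y => ?_
    rw [hV, hnorm]
  · simpa [A, B] using hV (Finsupp.single i 1)

/-! ### The spectral density and its feature vectors. -/

section SpectralDensity

open scoped Real ComplexConjugate

/-- `G` is a nonnegative integrable function with `charFun μ t = ∫ exp(2 π i η t) G(η) dη`. -/
structure IsSpectralDensity (μ : Measure ℝ) (G : ℝ → ℝ) : Prop where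
  measurable : Measurable G
  nonneg : ∀ x, 0 ≤ G x
  integrable : Integrable G
  charFun_eq : ∀ t, charFun μ t = ∫ η, (𝐞 (η * t) : ℂ) * (G η : ℂ)

theorem exists_isSpectralDensity {μ : Measure ℝ} [IsFiniteMeasure μ]
    (hg : MemLp (charFun μ) 2 (volume : Measure ℝ)) : ∃ G, IsSpectralDensity μ G := by
  -- The dilation turns `exp(iξt)` into `𝐞 (η * t)`.
  set ν : Measure ℝ := μ.map (fun ξ => (2 * π)⁻¹ * ξ)
  have hν : ∀ t, charFun μ t = ∫ η, (𝐞 (η * t) : ℂ) ∂ν := by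
    intro t
    rw [integral_map (by fun_prop) (by fun_prop), charFun_apply_real]
    refine integral_congr_ae (ae_of_all _ fun ξ => ?_)
    simp only [Real.fourierChar_apply]
    congr 1
    push_cast
    field_simp
  obtain ⟨h1, h2, h3⟩ := fourier_density (ν := ν) (f := hg.toLp) (by
    filter_upwards [hg.coeFn_toLp] with x hx
    rw [hx, hν])
  set K : Lp ℂ 2 (volume : Measure ℝ) := 𝓕 hg.toLp
  -- Truncation at `0` selects a representative that is nonnegative everywhere.
  have hK : ∀ᵐ x, K x = ((max (K x).re 0 : ℝ) : ℂ) := by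
    filter_upwards [h2] with x hx
    rw [max_eq_left hx.1]
    exact Complex.ext rfl hx.2
  refine ⟨fun x => max (K x).re 0, ?_, fun x => le_max_right _ _, ?_, fun t => ?_⟩
  · exact (Complex.measurable_re.comp (Lp.stronglyMeasurable K).measurable).max measurable_const
  · exact (h1.congr hK).re
  · rw [hν, h3]
    refine integral_congr_ae ?_
    filter_upwards [hK] with x hx
    rw [hx]
    norm_num

namespace IsSpectralDensity

variable {μ : Measure ℝ} {G : ℝ → ℝ}

theorem fourier_toLp (hG : IsSpectralDensity μ G) (hg : MemLp (charFun μ) 2 (volume : Measure ℝ)) :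
    (𝓕 hg.toLp : Lp ℂ 2 (volume : Measure ℝ)) =ᵐ[volume] fun x => (G x : ℂ) := by
  refine fourier_ae_eq_of_ae_eq_integral hG.integrable.ofReal ?_
  filter_upwards [hg.coeFn_toLp] with x hx
  rw [hx, hG.charFun_eq]
  rfl

theorem memLp_two (hG : IsSpectralDensity μ G) (hg : MemLp (charFun μ) 2 (volume : Measure ℝ)) :
    MemLp (fun x => (G x : ℂ)) 2 volume :=
  (memLp_congr_ae (hG.fourier_toLp hg)).1 (Lp.memLp _)

theorem memLp_sqrt (hG : IsSpectralDensity μ G) : MemLp (fun x => (√(G x) : ℂ)) 2 volume := by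
  rw [memLp_two_iff_integrable_sq_norm]
  · refine hG.integrable.congr (ae_of_all _ fun x => ?_)
    simp [Real.sq_sqrt (hG.nonneg x)]
  · have := hG.measurable
    exact Measurable.aestronglyMeasurable (by fun_prop)

theorem memLp_fourierChar_mul {f : ℝ → ℂ} (hf : MemLp f 2 volume) (y : ℝ) :
    MemLp (fun η => (𝐞 (-(η * y)) : ℂ) * f η) 2 volume := by
  refine hf.of_le (.mul (Continuous.aestronglyMeasurable (by fun_prop)) hf.1) (ae_of_all _ fun η => ?_)
  rw [norm_mul, Circle.norm_coe, one_mul]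

/-- The `L²` functions whose Gram matrix is the stationary kernel. -/
noncomputable def feature (hG : IsSpectralDensity μ G) (y : ℝ) : Lp ℂ 2 (volume : Measure ℝ) :=
  (memLp_fourierChar_mul hG.memLp_sqrt y).toLp

theorem inner_toLp_fourierChar {f : ℝ → ℂ} (hf : MemLp f 2 volume) (y : ℝ)
    (F : Lp ℂ 2 (volume : Measure ℝ)) :
    inner ℂ (memLp_fourierChar_mul hf y).toLp F = ∫ η, (𝐞 (η * y) : ℂ) * (conj (f η) * F η) := by
  rw [L2.inner_def]
  refine integral_congr_ae ?_
  filter_upwards [(memLp_fourierChar_mul hf y).coeFn_toLp] with η hη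
  rw [hη, RCLike.inner_apply, map_mul, ← Circle.coe_inv_eq_conj, ← AddChar.map_neg_eq_inv, neg_neg]
  ring

theorem inner_feature (hG : IsSpectralDensity μ G) (y : ℝ) (F : Lp ℂ 2 (volume : Measure ℝ)) :
    inner ℂ (hG.feature y) F = ∫ η, (𝐞 (η * y) : ℂ) * (√(G η) * F η) := by
  rw [feature, inner_toLp_fourierChar hG.memLp_sqrt]
  simp

theorem inner_feature_feature (hG : IsSpectralDensity μ G) (x y : ℝ) :
    inner ℂ (hG.feature x) (hG.feature y) = charFun μ (x - y) := by
  rw [inner_feature, hG.charFun_eq]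
  refine integral_congr_ae ?_
  filter_upwards [(memLp_fourierChar_mul hG.memLp_sqrt y).coeFn_toLp] with η hη
  have h : ((√(G η) : ℝ) : ℂ) * (√(G η) : ℝ) = G η := by
    rw [← Complex.ofReal_mul, Real.mul_self_sqrt (hG.nonneg η)]
  rw [feature, hη, mul_sub, sub_eq_add_neg, AddChar.map_add_eq_mul, Circle.coe_mul, ← h]
  ring

end IsSpectralDensity

end SpectralDensity

/-! ### The operator in the Fourier picture and its resolvent. -/

section StationaryRKHS

open scoped Real ComplexConjugate

variable {μ : Measure ℝ} {G : ℝ → ℝ} {H : Type*} [NormedAddCommGroup H] [InnerProductSpace ℂ H]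
  [CompleteSpace H] [RKHS ℂ H ℝ ℂ]

theorem dense_kernelSpan {X : Type*} {H : Type*} [NormedAddCommGroup H] [InnerProductSpace ℂ H]
    [CompleteSpace H] [RKHS ℂ H X ℂ] : Dense (kernelSpan (X := X) H : Set H) := by
  rw [Submodule.dense_iff_topologicalClosure_eq_top, ← RKHS.kerFun_dense (𝕜 := ℂ) H (X := X)]
  congr 1
  refine le_antisymm (Submodule.span_mono ?_) (Submodule.span_le.2 ?_)
  · rintro _ ⟨y, rfl⟩
    exact ⟨y, 1, rfl⟩
  · rintro _ ⟨y, v, rfl⟩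
    have : RKHS.kerFun H y v = v • RKHS.kerFun H y (1 : ℂ) := by
      rw [← map_smul, smul_eq_mul, mul_one]
    rw [this]
    exact Submodule.smul_mem _ _ (Submodule.subset_span ⟨y, rfl⟩)

/-- The kernel section `K(·, y)` as an element of the domain of `stationaryInclusion`. -/
noncomputable def kernelSection (hH : HasStationaryKernel H μ)
    (hg : MemLp (charFun μ) 2 (volume : Measure ℝ)) (y : ℝ) : (stationaryInclusion hH hg).domain :=
  ⟨RKHS.kerFun H y (1 : ℂ), Submodule.subset_span ⟨y, rfl⟩⟩

theorem forall_inner_eq_of_kernelSection (hH : HasStationaryKernel H μ)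
    (hg : MemLp (charFun μ) 2 (volume : Measure ℝ)) {w : H} {ψ : Lp ℂ 2 (volume : Measure ℝ)}
    (h : ∀ y, inner ℂ w (kernelSection hH hg y : H) =
      inner ℂ ψ (stationaryInclusion hH hg (kernelSection hH hg y)))
    (u : (stationaryInclusion hH hg).domain) :
    inner ℂ w (u : H) = inner ℂ ψ (stationaryInclusion hH hg u) := by
  obtain ⟨u, hu⟩ := u
  have hu' : u ∈ kernelSpan (X := ℝ) H := hu
  induction hu' using Submodule.span_induction with
  | mem x hx =>
    obtain ⟨y, rfl⟩ := hx
    exact h y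
  | zero =>
    exact (inner_zero_right w).trans
      ((congrArg (inner ℂ ψ) (stationaryInclusion hH hg).map_zero).trans (inner_zero_right ψ)).symm
  | add x y hx hy ihx ihy =>
    have hx' : x ∈ (stationaryInclusion hH hg).domain := hx
    have hy' : y ∈ (stationaryInclusion hH hg).domain := hy
    have := congrArg (inner ℂ ψ) ((stationaryInclusion hH hg).map_add ⟨x, hx'⟩ ⟨y, hy'⟩)
    rw [inner_add_right, ← ihx hx', ← ihy hy', ← inner_add_right] at this
    exact this.symm
  | smul a x hx ih =>
    have hx' : x ∈ (stationaryInclusion hH hg).domain := hx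
    have := congrArg (inner ℂ ψ) ((stationaryInclusion hH hg).map_smul a ⟨x, hx'⟩)
    rw [inner_smul_right, ← ih hx', ← inner_smul_right] at this
    exact this.symm

namespace IsSpectralDensity

theorem fourier_stationaryInclusion (hG : IsSpectralDensity μ G) (hH : HasStationaryKernel H μ)
    (hg : MemLp (charFun μ) 2 (volume : Measure ℝ)) (y : ℝ) :
    𝓕 (stationaryInclusion hH hg (kernelSection hH hg y)) =
      (memLp_fourierChar_mul (hG.memLp_two hg) y).toLp := by
  refine Lp.ext ?_
  refine (fourier_ae_eq_of_ae_eq_integral (h := fun η => (𝐞 (-(η * y)) : ℂ) * (G η : ℂ)) ?_ ?_).trans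
    (MemLp.coeFn_toLp _).symm
  · refine hG.integrable.ofReal.bdd_mul (c := 1) (by fun_prop) (ae_of_all _ fun η => ?_)
    exact (Circle.norm_coe _).le
  · filter_upwards [(hH.memLp_kerFun hg y).coeFn_toLp] with x hx
    refine hx.trans ?_
    rw [RKHS.kerFun_apply, hH, hG.charFun_eq, mul_one]
    refine integral_congr_ae (ae_of_all _ fun η => ?_)
    simp only [mul_sub]
    rw [sub_eq_add_neg, AddChar.map_add_eq_mul, Circle.coe_mul, mul_assoc]

theorem inner_stationaryInclusion (hG : IsSpectralDensity μ G) (hH : HasStationaryKernel H μ)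
    (hg : MemLp (charFun μ) 2 (volume : Measure ℝ)) (y : ℝ) (χ : Lp ℂ 2 (volume : Measure ℝ)) :
    inner ℂ (stationaryInclusion hH hg (kernelSection hH hg y)) χ =
      ∫ η, (𝐞 (η * y) : ℂ) * (G η * (𝓕 χ : Lp ℂ 2 (volume : Measure ℝ)) η) := by
  rw [← Lp.inner_fourier_eq, hG.fourier_stationaryInclusion hH hg,
    inner_toLp_fourierChar (hG.memLp_two hg)]
  simp

theorem exists_linearIsometry (hG : IsSpectralDensity μ G) (hH : HasStationaryKernel H μ)
    (hg : MemLp (charFun μ) 2 (volume : Measure ℝ)) :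
    ∃ V : H →ₗᵢ[ℂ] Lp ℂ 2 (volume : Measure ℝ),
      ∀ y, V (kernelSection hH hg y) = hG.feature y := by
  refine exists_linearIsometry_of_inner_eq (fun x y => ?_) dense_kernelSpan
  change inner ℂ (RKHS.kerFun H x (1 : ℂ)) (RKHS.kerFun H y (1 : ℂ)) = _
  rw [RKHS.kerFun_inner, RKHS.kerFun_apply, hH, inner_feature_feature]
  simp

/-- Pairing `T† χ` with every kernel section shows that both sides, which are in `L¹`, have the same
inverse Fourier transform. The extra factor `√G` is harmless: the vector paired with `V (T† χ)`
later also carries one. -/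
theorem isometry_adjoint_ae_eq (hG : IsSpectralDensity μ G) (hH : HasStationaryKernel H μ)
    (hg : MemLp (charFun μ) 2 (volume : Measure ℝ)) {V : H →ₗᵢ[ℂ] Lp ℂ 2 (volume : Measure ℝ)}
    (hV : ∀ y, V (kernelSection hH hg y) = hG.feature y) (χ : (stationaryInclusion hH hg)†.domain) :
    (fun η => (√(G η) : ℂ) * V ((stationaryInclusion hH hg)† χ) η) =ᵐ[volume]
      fun η => (G η : ℂ) * (𝓕 (χ : Lp ℂ 2 (volume : Measure ℝ)) : Lp ℂ 2 (volume : Measure ℝ)) η := by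
  refine ae_eq_of_integral_fourierChar_eq (hG.memLp_sqrt.integrable_mul (Lp.memLp _))
    ((hG.memLp_two hg).integrable_mul (Lp.memLp _)) fun y => ?_
  rw [← hG.inner_feature, ← hG.inner_stationaryInclusion hH hg, ← hV, V.inner_map_map]
  exact ((LinearPMap.adjoint_isFormalAdjoint dense_kernelSpan).symm (kernelSection hH hg y) χ).symm

theorem _root_.MeasureTheory.MemLp.ofReal_mul_of_bound {f : ℝ → ℂ} {p : ENNReal}
    (hf : MemLp f p volume) {m : ℝ → ℝ} (hm : Measurable m) {C : ℝ} (hC : ∀ x, |m x| ≤ C) :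
    MemLp (fun x => (m x : ℂ) * f x) p volume := by
  refine hf.of_le_mul (c := C)
    (.mul (Measurable.aestronglyMeasurable (by fun_prop)) hf.1) (ae_of_all _ fun x => ?_)
  rw [norm_mul, Complex.norm_real]
  exact mul_le_mul_of_nonneg_right (hC x) (norm_nonneg _)

/-- The resolvent `ψ = (α + T T†)⁻¹ φ` as a Fourier multiplier, in weak form: `w = T† ψ`,
`S = T w` and `α ψ + S = φ`. -/
theorem exists_resolvent (hG : IsSpectralDensity μ G) (hH : HasStationaryKernel H μ)
    (hg : MemLp (charFun μ) 2 (volume : Measure ℝ)) {α : ℝ} (hα : 0 < α)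
    (φ : Lp ℂ 2 (volume : Measure ℝ)) :
    ∃ (ψ S : Lp ℂ 2 (volume : Measure ℝ)) (w : H),
      (∀ u : (stationaryInclusion hH hg).domain,
        inner ℂ w (u : H) = inner ℂ ψ (stationaryInclusion hH hg u)) ∧
      (∀ χ : (stationaryInclusion hH hg)†.domain,
        inner ℂ ((stationaryInclusion hH hg)† χ) w =
          inner ℂ (χ : Lp ℂ 2 (volume : Measure ℝ)) S) ∧
      (α : ℂ) • ψ + S = φ ∧
      (𝓕 ψ : Lp ℂ 2 (volume : Measure ℝ)) =ᵐ[volume]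
        (fun η => (((α + G η)⁻¹ : ℝ) : ℂ) * (𝓕 φ : Lp ℂ 2 (volume : Measure ℝ)) η) ∧
      (𝓕 S : Lp ℂ 2 (volume : Measure ℝ)) =ᵐ[volume]
        (fun η => ((G η * (α + G η)⁻¹ : ℝ) : ℂ) * (𝓕 φ : Lp ℂ 2 (volume : Measure ℝ)) η) := by
  obtain ⟨V, hV⟩ := hG.exists_linearIsometry hH hg
  have hm := hG.measurable
  have h0 := hG.nonneg
  have hpos : ∀ x, 0 < α + G x := fun x => add_pos_of_pos_of_nonneg hα (h0 x)
  set Φ : Lp ℂ 2 (volume : Measure ℝ) := 𝓕 φ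
  have m1 : MemLp (fun η => (((α + G η)⁻¹ : ℝ) : ℂ) * Φ η) 2 volume :=
    (Lp.memLp Φ).ofReal_mul_of_bound (C := α⁻¹) (by fun_prop) fun x => by
      rw [abs_of_pos (inv_pos.2 (hpos x))]
      exact inv_anti₀ hα (le_add_of_nonneg_right (h0 x))
  have m2 : MemLp (fun η => ((G η * (α + G η)⁻¹ : ℝ) : ℂ) * Φ η) 2 volume :=
    (Lp.memLp Φ).ofReal_mul_of_bound (C := 1) (by fun_prop) fun x => by
      rw [abs_of_nonneg (mul_nonneg (h0 x) (inv_pos.2 (hpos x)).le), ← div_eq_mul_inv,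
        div_le_one (hpos x)]
      linarith
  -- The bound follows from `√G ≤ 1 + G ≤ (1 + α⁻¹)(α + G)`.
  have m3 : MemLp (fun η => ((√(G η) * (α + G η)⁻¹ : ℝ) : ℂ) * Φ η) 2 volume :=
    (Lp.memLp Φ).ofReal_mul_of_bound (C := 1 + α⁻¹) (by fun_prop) fun x => by
      rw [abs_of_nonneg (mul_nonneg (Real.sqrt_nonneg _) (inv_pos.2 (hpos x)).le),
        ← div_eq_mul_inv, div_le_iff₀ (hpos x)]
      have h1 : √(G x) ≤ 1 + G x := by
        nlinarith [Real.sq_sqrt (h0 x), sq_nonneg (√(G x) - 1), Real.sqrt_nonneg (G x)]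
      have h2 : α⁻¹ * α = 1 := inv_mul_cancel₀ hα.ne'
      nlinarith [mul_nonneg (inv_pos.2 hα).le (h0 x)]
  set ψ : Lp ℂ 2 (volume : Measure ℝ) := 𝓕⁻ m1.toLp
  set S : Lp ℂ 2 (volume : Measure ℝ) := 𝓕⁻ m2.toLp
  have hψ : 𝓕 ψ = m1.toLp := fourier_fourierInv_eq _
  have hS : 𝓕 S = m2.toLp := fourier_fourierInv_eq _
  -- Surjectivity of `V` is not needed: the adjoint already has the right pairing with every vector
  -- of the range.
  set w : H := V.toContinuousLinearMap.adjoint m3.toLp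
  have hw : ∀ u : H, inner ℂ u w = inner ℂ (V u) m3.toLp := fun u =>
    ContinuousLinearMap.adjoint_inner_right _ _ _
  refine ⟨ψ, S, w, ?_, ?_, ?_, ?_, ?_⟩
  · refine forall_inner_eq_of_kernelSection hH hg fun y => ?_
    rw [← inner_conj_symm, hw, hV, inner_feature, ← inner_conj_symm ψ,
      hG.inner_stationaryInclusion, hψ]
    refine congrArg conj (integral_congr_ae ?_)
    filter_upwards [m1.coeFn_toLp, m3.coeFn_toLp] with η h1 h3
    rw [h1, h3]
    have h : ((√(G η) : ℝ) : ℂ) * (√(G η) : ℝ) = G η := by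
      rw [← Complex.ofReal_mul, Real.mul_self_sqrt (h0 η)]
    rw [← h]
    push_cast
    ring
  · intro χ
    rw [hw, ← Lp.inner_fourier_eq (χ : Lp ℂ 2 (volume : Measure ℝ)), hS, L2.inner_def, L2.inner_def]
    refine integral_congr_ae ?_
    filter_upwards [m2.coeFn_toLp, m3.coeFn_toLp, hG.isometry_adjoint_ae_eq hH hg hV χ]
      with η h2 h3 h
    have h' := congrArg conj h
    simp only [map_mul, Complex.conj_ofReal] at h'
    rw [h2, h3, RCLike.inner_apply, RCLike.inner_apply]
    push_cast
    linear_combination ((α : ℂ) + G η)⁻¹ * Φ η * h'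
  · apply (Lp.fourierTransformₗᵢ ℝ ℂ).injective
    rw [map_add, map_smul]
    change (α : ℂ) • 𝓕 ψ + 𝓕 S = Φ
    rw [hψ, hS]
    refine Lp.ext ?_
    filter_upwards [m1.coeFn_toLp, m2.coeFn_toLp, Lp.coeFn_add ((α : ℂ) • m1.toLp) m2.toLp,
      Lp.coeFn_smul (α : ℂ) m1.toLp] with η h1 h2 h3 h4
    rw [h3, Pi.add_apply, h4, Pi.smul_apply, h1, h2, smul_eq_mul]
    have : (α : ℂ) + G η ≠ 0 := by exact_mod_cast (hpos η).ne'
    push_cast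
    field_simp
  · rw [hψ]
    exact m1.coeFn_toLp
  · rw [hS]
    exact m2.coeFn_toLp

/-- If `φ` is orthogonal to the domain, the resolvent at `α = 1` gives `0 = ⟨ψ, φ⟩ = ‖ψ‖² + ‖w‖²`.
Hence `ψ = 0`, and `φ = 0` because the multiplier `(1 + G)⁻¹` never vanishes. -/
theorem dense_adjoint_domain (hG : IsSpectralDensity μ G) (hH : HasStationaryKernel H μ)
    (hg : MemLp (charFun μ) 2 (volume : Measure ℝ)) :
    Dense ((stationaryInclusion hH hg)†.domain : Set (Lp ℂ 2 (volume : Measure ℝ))) := by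
  rw [Submodule.dense_iff_topologicalClosure_eq_top, Submodule.topologicalClosure_eq_top_iff,
    Submodule.eq_bot_iff]
  intro φ hφ
  obtain ⟨ψ, S, w, hw, hS, rfl, hψ, hSφ⟩ := hG.exists_resolvent hH hg one_pos φ
  have hd : ψ ∈ (stationaryInclusion hH hg)†.domain :=
    LinearPMap.mem_adjoint_domain_of_exists _ ⟨w, hw⟩
  have hin := Submodule.mem_orthogonal _ _ |>.1 hφ ψ hd
  have hSw := hS ⟨ψ, hd⟩
  rw [LinearPMap.adjoint_apply_eq dense_kernelSpan _ hw, inner_self_eq_norm_sq_to_K] at hSw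
  rw [inner_add_right, inner_smul_right, ← hSw, inner_self_eq_norm_sq_to_K] at hin
  have hz : ‖ψ‖ ^ 2 + ‖w‖ ^ 2 = 0 := by
    apply Complex.ofReal_injective
    simpa using hin
  have hψ0 : ψ = 0 := by
    rw [← norm_eq_zero]
    nlinarith [sq_nonneg ‖ψ‖, sq_nonneg ‖w‖]
  apply (Lp.fourierTransformₗᵢ ℝ ℂ).injective
  rw [map_zero]
  refine Lp.ext ?_
  have h0 : (𝓕 ψ : Lp ℂ 2 (volume : Measure ℝ)) = 0 := by
    rw [hψ0]
    exact map_zero (Lp.fourierTransformₗᵢ ℝ ℂ)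
  rw [h0] at hψ
  filter_upwards [hψ, Lp.coeFn_zero ℂ 2 (volume : Measure ℝ)] with η h1 h2
  rw [h2] at h1 ⊢
  have hne : (((1 + G η)⁻¹ : ℝ) : ℂ) ≠ 0 := by
    exact_mod_cast (inv_pos.2 (add_pos_of_pos_of_nonneg one_pos (hG.nonneg η))).ne'
  exact (mul_eq_zero.1 h1.symm).resolve_left hne

end IsSpectralDensity

end StationaryRKHS

/-- Upgrades the weak identities to genuine ones for the closure, whose adjoint is still `T†`. -/
theorem LinearPMap.IsClosable.exists_isRegularized {H L : Type*} [NormedAddCommGroup H]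
    [InnerProductSpace ℂ H] [NormedAddCommGroup L] [InnerProductSpace ℂ L] [CompleteSpace H]
    [CompleteSpace L] {T : H →ₗ.[ℂ] L} (hc : T.IsClosable) (hT : Dense (T.domain : Set H))
    {α : ℝ} {φ ψ S : L} {w : H}
    (hw : ∀ u : T.domain, inner ℂ w (u : H) = inner ℂ ψ (T u))
    (hS : ∀ χ : T†.domain, inner ℂ (T† χ) w = inner ℂ (χ : L) S) (h : (α : ℂ) • ψ + S = φ) :
    ∃ (ψ' : T.closure†.domain) (f : T.closure.domain), (ψ' : L) = ψ ∧ (f : H) = w ∧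
      T.closure f = S ∧ IsRegularized T.closure α φ ψ' f := by
  have hd : ψ ∈ T†.domain := mem_adjoint_domain_of_exists _ ⟨w, hw⟩
  have h1 : (ψ, w) ∈ T.closure†.graph := by
    rw [hc.adjoint_closure hT]
    exact (mem_graph_iff _).2 ⟨⟨ψ, hd⟩, rfl, adjoint_apply_eq hT _ hw⟩
  obtain ⟨ψ', hψ', hψ''⟩ := (mem_graph_iff _).1 h1
  obtain ⟨f, hf, hf'⟩ := (mem_graph_iff _).1 (hc.mem_graph_closure hT hS)
  refine ⟨ψ', f, hψ', hf, hf', ?_, ?_⟩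
  · rw [hf, hψ'']
  · rw [hψ', hf', h]

/-! ### Plancherel for multipliers and change of frequency variable. -/

section Rescaling

open scoped Real

theorem inner_eq_integral_of_ae_eq_ofReal_mul {A B Φ : Lp ℂ 2 (volume : Measure ℝ)} {a b : ℝ → ℝ}
    (hA : A =ᵐ[volume] fun η => (a η : ℂ) * Φ η) (hB : B =ᵐ[volume] fun η => (b η : ℂ) * Φ η) :
    Integrable (fun η => a η * b η * ‖Φ η‖ ^ 2) ∧
      inner ℂ A B = ((∫ η, a η * b η * ‖Φ η‖ ^ 2 : ℝ) : ℂ) := by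
  have h : (fun η => inner ℂ (A η) (B η)) =ᵐ[volume]
      fun η => ((a η * b η * ‖Φ η‖ ^ 2 : ℝ) : ℂ) := by
    filter_upwards [hA, hB] with η h1 h2
    have := Complex.mul_conj' (Φ η)
    rw [h1, h2, RCLike.inner_apply, map_mul, Complex.conj_ofReal]
    push_cast
    linear_combination (a η : ℂ) * b η * this
  refine ⟨((L2.integrable_inner A B).congr h).re, ?_⟩
  rw [L2.inner_def, integral_congr_ae h]
  exact integral_ofReal

/-- Nonzero dilations preserve null sets, so a.e. statements about `𝓕` transfer to `l2Fourier`. -/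
theorem ae_comp_mul_left {P : ℝ → Prop} {a : ℝ} (ha : a ≠ 0) (h : ∀ᵐ x, P x) :
    ∀ᵐ x, P (a * x) := by
  have hq : Measure.QuasiMeasurePreserving (a * ·) (volume : Measure ℝ) volume := by
    refine ⟨by fun_prop, ?_⟩
    rw [Real.map_volume_mul_left ha]
    exact Measure.smul_absolutelyContinuous
  exact hq.ae h

theorem l2Fourier_apply (c : ℝ) (u : Lp ℂ 2 (volume : Measure ℝ)) (ξ : ℝ) :
    l2Fourier c u ξ = (𝓕 u : Lp ℂ 2 (volume : Measure ℝ)) (-(c / (2 * π)) * ξ) := by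
  rw [l2Fourier]
  congr 1
  ring

theorem integrable_and_integral_comp_rescale {c : ℝ} (hc : c ≠ 0) {F : ℝ → ℝ} {K : ℝ → ℝ}
    (hF : Integrable F) (hK : ∀ᵐ ξ, K ξ = F (-(c / (2 * π)) * ξ)) :
    Integrable K ∧ ∫ η, F η = |c| / (2 * π) * ∫ ξ, K ξ := by
  have ha : -(c / (2 * π)) ≠ 0 := neg_ne_zero.2 (div_ne_zero hc (by positivity))
  refine ⟨(hF.comp_mul_left' ha).congr (hK.mono fun _ h => h.symm), ?_⟩
  rw [integral_congr_ae hK, Measure.integral_comp_mul_left, smul_eq_mul, abs_inv, abs_neg, abs_div,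
    abs_of_pos Real.two_pi_pos, ← mul_assoc, mul_inv_cancel₀, one_mul]
  exact div_ne_zero (abs_ne_zero.2 hc) Real.two_pi_pos.ne'

end Rescaling

/-! ### The spectral formulas. -/

theorem theorem6 (μ : Measure ℝ) [IsProbabilityMeasure μ]
    {H : Type*} [NormedAddCommGroup H] [InnerProductSpace ℂ H] [CompleteSpace H]
    [RKHS ℂ H ℝ ℂ] (hH : HasStationaryKernel H μ)
    (hg : MemLp (charFun μ) 2 (volume : Measure ℝ))
    (α : ℝ) (hα : 0 < α) (φ : Lp ℂ 2 (volume : Measure ℝ)) :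
    -- the operator on the span of the kernel sections is densely defined and closable, so that
    -- its closure `T` and the adjoint of `T` are meaningful
    Dense ((stationaryInclusion hH hg).domain : Set H) ∧
    (stationaryInclusion hH hg).IsClosable ∧
    -- `ψ = (α + T T†)⁻¹ φ` exists and is unique
    (∃! ψ : (stationaryOperator hH hg)†.domain, ∃ f : (stationaryOperator hH hg).domain,
      IsRegularized (stationaryOperator hH hg) α φ ψ f) ∧
    -- for `f = T† (α + T T†)⁻¹ φ`:
    ∀ (ψ : (stationaryOperator hH hg)†.domain) (f : (stationaryOperator hH hg).domain),
      IsRegularized (stationaryOperator hH hg) α φ ψ f →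
      -- `f` is the unique minimizer of the regularized least squares functional
      (∀ u : (stationaryOperator hH hg).domain, u ≠ f →
        ‖φ - stationaryOperator hH hg f‖ ^ 2 + α * ‖(f : H)‖ ^ 2 <
          ‖φ - stationaryOperator hH hg u‖ ^ 2 + α * ‖(u : H)‖ ^ 2) ∧
      -- spectral formulas, for the Fourier transform with any kernel `exp(i c ξ x)`, `c ≠ 0`
      ∀ c : ℝ, c ≠ 0 →
        (∀ᵐ ξ : ℝ, 0 ≤ (l2Fourier c hg.toLp ξ).re ∧ (l2Fourier c hg.toLp ξ).im = 0) ∧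
        (∀ᵐ ξ : ℝ, l2Fourier c (stationaryOperator hH hg f) ξ =
          l2Fourier c hg.toLp ξ / ((α : ℂ) + l2Fourier c hg.toLp ξ) * l2Fourier c φ ξ) ∧
        (Integrable (fun ξ : ℝ =>
            (l2Fourier c hg.toLp ξ).re / (α + (l2Fourier c hg.toLp ξ).re) ^ 2 * ‖l2Fourier c φ ξ‖ ^ 2) ∧
          ‖(f : H)‖ ^ 2 = |c| / (2 * Real.pi) * ∫ ξ : ℝ,
            (l2Fourier c hg.toLp ξ).re / (α + (l2Fourier c hg.toLp ξ).re) ^ 2 * ‖l2Fourier c φ ξ‖ ^ 2) ∧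
        (Integrable (fun ξ : ℝ =>
            (l2Fourier c hg.toLp ξ).re / (α + (l2Fourier c hg.toLp ξ).re) * ‖l2Fourier c φ ξ‖ ^ 2) ∧
          weightedNormSq α (graphMap (stationaryOperator hH hg) f) =
            |c| / (2 * Real.pi) * ∫ ξ : ℝ,
              (l2Fourier c hg.toLp ξ).re / (α + (l2Fourier c hg.toLp ξ).re) * ‖l2Fourier c φ ξ‖ ^ 2) := by
  obtain ⟨G, hG⟩ := exists_isSpectralDensity hg
  have hd : Dense ((stationaryInclusion hH hg).domain : Set H) := dense_kernelSpan
  have hcl := LinearPMap.isClosable_of_dense_adjoint_domain hd (hG.dense_adjoint_domain hH hg)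
  have hT : Dense ((stationaryOperator hH hg).domain : Set H) :=
    hd.mono (LinearPMap.le_closure _).1
  obtain ⟨ψ₀, S, w, hw, hS, hsum, hψ, hSF⟩ := hG.exists_resolvent hH hg hα φ
  obtain ⟨ψ₁, f₁, hψ₁, hf₁, hTf₁, hreg⟩ := hcl.exists_isRegularized hd hw hS hsum
  refine ⟨hd, hcl, ⟨ψ₁, ⟨f₁, hreg⟩, fun ψ ⟨f, h⟩ => h.unique hT hα hreg⟩, fun ψ f h => ?_⟩
  refine ⟨fun u hu => h.lt_of_ne hT hα hu, fun c hc => ?_⟩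
  obtain rfl : ψ = ψ₁ := h.unique hT hα hreg
  obtain rfl : f = f₁ := Subtype.ext (h.1.trans hreg.1.symm)
  have hTf : stationaryOperator hH hg f = S := hTf₁
  -- The weak identity for `S`, tested at `χ = ψ₀`, where `T† ψ₀ = w`.
  have hw' : inner ℂ w w = inner ℂ ψ₀ S := by
    have hdψ : ψ₀ ∈ (stationaryInclusion hH hg)†.domain :=
      LinearPMap.mem_adjoint_domain_of_exists _ ⟨w, hw⟩
    have := hS ⟨ψ₀, hdψ⟩
    rwa [LinearPMap.adjoint_apply_eq hd _ hw] at this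
  have ha : -(c / (2 * Real.pi)) ≠ 0 := neg_ne_zero.2 (div_ne_zero hc (by positivity))
  have hg' : ∀ᵐ ξ, l2Fourier c hg.toLp ξ = (G (-(c / (2 * Real.pi)) * ξ) : ℂ) := by
    filter_upwards [ae_comp_mul_left ha (hG.fourier_toLp hg)] with ξ hξ
    rw [l2Fourier_apply, hξ]
  obtain ⟨i1, e1⟩ := inner_eq_integral_of_ae_eq_ofReal_mul hψ hSF
  -- Here `𝓕 φ` is taken as its own multiple by `1`, to compute `⟨φ, S⟩`.
  obtain ⟨i2, e2⟩ := inner_eq_integral_of_ae_eq_ofReal_mul (A := 𝓕 φ) (a := fun _ => 1)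
    (Filter.Eventually.of_forall fun η => by simp) hSF
  rw [Lp.inner_fourier_eq] at e1 e2
  have n1 : ‖w‖ ^ 2 = ∫ η, (α + G η)⁻¹ * (G η * (α + G η)⁻¹) *
      ‖(𝓕 φ : Lp ℂ 2 (volume : Measure ℝ)) η‖ ^ 2 := by
    apply Complex.ofReal_injective
    rw [← e1, ← hw', inner_self_eq_norm_sq_to_K]
    simp
  have n2 : α * ‖w‖ ^ 2 + ‖S‖ ^ 2 = ∫ η, 1 * (G η * (α + G η)⁻¹) *
      ‖(𝓕 φ : Lp ℂ 2 (volume : Measure ℝ)) η‖ ^ 2 := by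
    apply Complex.ofReal_injective
    rw [← e2, ← hsum, inner_add_left, inner_smul_left, ← hw', inner_self_eq_norm_sq_to_K,
      inner_self_eq_norm_sq_to_K]
    simp
  refine ⟨?_, ?_, ?_, ?_⟩
  · filter_upwards [hg'] with ξ hξ
    rw [hξ]
    exact ⟨hG.nonneg _, Complex.ofReal_im _⟩
  · filter_upwards [hg', ae_comp_mul_left ha hSF] with ξ h1 h2
    rw [hTf, h1, l2Fourier_apply, l2Fourier_apply, h2]
    rw [div_eq_mul_inv (G _ : ℂ)]
    push_cast
    rfl
  · rw [hf₁, n1]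
    refine integrable_and_integral_comp_rescale hc i1 ?_
    filter_upwards [hg'] with ξ h1
    rw [h1, Complex.ofReal_re, l2Fourier_apply, div_eq_mul_inv, sq (α + _), mul_inv]
    ring
  · rw [weightedNormSq, graphMap, hTf]
    dsimp only
    rw [hf₁, n2]
    refine integrable_and_integral_comp_rescale hc i2 ?_
    filter_upwards [hg'] with ξ h1
    rw [h1, Complex.ofReal_re, l2Fourier_apply, div_eq_mul_inv]
    ring
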